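/- Let $\Omega\subset\mathbb{R}^2$ be a bounded open set, let $f\in L^1(\Omega)$ and let $\lambda,c\in\mathbb{R}$. Let $W^{2,2}_0(\Omega)$ be the completion of $C_c^\infty(\Omega)$ in the norm $\|u\|_{W^{2,2}}=\big(\sum_{|\alpha|\le 2}\|\partial^\alpha u\|_{L^2(\Omega)}^2\big)^{1/2}$, let $W^{-2,2}(\Omega)$ be its dual, and let $J_\lambda:W^{2,2}_0(\Omega)\to\mathbb{R}$ be the functional $$J_\lambda(u)=\frac12\int_\Omega|\Delta u|^2\,dx-\int_\Omega u_{x_1}u_{x_2}u_{x_1x_2}\,dx-\lambda\int_\Omega f\,u\,dx .$$ Let $(u_k)_{k\in\mathbb{N}}$ be a bounded sequence in $W^{2,2}_0(\Omega)$ such that $J_\lambda(u_k)\to c$ and $J_\lambda'(u_k)\to 0$ in the norm of $W^{-2,2}(\Omega)$, where $J_\lambda'$ denotes the Fréchet derivative. Then $(u_k)$ has a subsequence that converges strongly in $W^{2,2}_0(\Omega)$. -/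

import Mathlib

open Set Filter Topology MeasureTheory TopologicalSpace
open scoped ContDiff Distributions ENNReal

noncomputable section

namespace EpitaxialGrowth

/-- The plane `ℝ²`, written in coordinates `x = (x₁, x₂)`, with Lebesgue measure `volume`
(the product norm of `ℝ × ℝ` is equivalent to the Euclidean one and is only used for
boundedness and differentiability). -/
abbrev Plane : Type := ℝ × ℝ

/-- The directional derivative `∂_v φ` of a test function `φ ∈ C_c^∞(Ω)`, as a linear map. -/
def dirDeriv (Ω : Opens Plane) (v : Plane) : 𝓓(Ω, ℝ) →ₗ[ℝ] 𝓓(Ω, ℝ) where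
  toFun φ :=
    { toFun := fun x => fderiv ℝ φ x v
      contDiff' := (φ.contDiff.fderiv_right (m := ∞) le_rfl).clm_apply contDiff_const
      hasCompactSupport' := φ.hasCompactSupport.fderiv_apply ℝ v
      tsupport_subset' := (tsupport_fderiv_apply_subset ℝ v).trans φ.tsupport_subset }
  map_add' φ ψ := by
    ext x
    change fderiv ℝ (⇑φ + ⇑ψ) x v = fderiv ℝ φ x v + fderiv ℝ ψ x v
    rw [fderiv_add (φ.contDiff.differentiable (by simp) x) (ψ.contDiff.differentiable (by simp) x)]
    rfl
  map_smul' c φ := by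
    ext x
    change fderiv ℝ (c • ⇑φ) x v = c • fderiv ℝ φ x v
    rw [fderiv_const_smul (φ.contDiff.differentiable (by simp) x)]
    rfl

/-- Multi-indices `α = (α₁, α₂)` of order `|α| = α₁ + α₂ ≤ 2`. -/
abbrev MultiIndex : Type := {α : Fin 3 × Fin 3 // (α.1 : ℕ) + (α.2 : ℕ) ≤ 2}

/-- The classical derivative `∂^α φ = ∂₁^{α₁} ∂₂^{α₂} φ` of a test function. -/
def testDeriv (Ω : Opens Plane) (α : MultiIndex) : 𝓓(Ω, ℝ) →ₗ[ℝ] 𝓓(Ω, ℝ) :=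
  ((dirDeriv Ω (1, 0)) ^ (α.1.1 : ℕ)) ∘ₗ ((dirDeriv Ω (0, 1)) ^ (α.1.2 : ℕ))

/-- The real Hilbert space `L²(Ω)`. -/
abbrev L2 (Ω : Opens Plane) : Type := Lp ℝ 2 (volume.restrict (Ω : Set Plane))

theorem memLp_test (Ω : Opens Plane) (φ : 𝓓(Ω, ℝ)) :
    MemLp φ 2 (volume.restrict (Ω : Set Plane)) :=
  (φ.continuous.memLp_of_hasCompactSupport φ.hasCompactSupport).restrict _

/-- A test function as an element of `L²(Ω)`. -/
def testToL2 (Ω : Opens Plane) : 𝓓(Ω, ℝ) →ₗ[ℝ] L2 Ω where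
  toFun φ := (memLp_test Ω φ).toLp φ
  map_add' _ _ := rfl
  map_smul' _ _ := rfl

/-- The space `∏_{|α| ≤ 2} L²(Ω)` with the norm `‖U‖² = ∑_{|α| ≤ 2} ‖U_α‖²_{L²(Ω)}`.
The map `u ↦ (∂^α u)_{|α| ≤ 2}` embeds `W^{2,2}(Ω)`, with its usual norm
`‖u‖²_{W^{2,2}} = ∑_{|α| ≤ 2} ‖∂^α u‖²_{L²(Ω)}`, isometrically into it. -/
abbrev Jets (Ω : Opens Plane) : Type := PiLp 2 (fun _ : MultiIndex => L2 Ω)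

/-- The embedding `φ ↦ (∂^α φ)_{|α| ≤ 2}` of `C_c^∞(Ω)`; the norm of the image is the
`W^{2,2}(Ω)`-norm of `φ`. -/
def jet (Ω : Opens Plane) : 𝓓(Ω, ℝ) →ₗ[ℝ] Jets Ω where
  toFun φ := WithLp.toLp 2 fun α => testToL2 Ω (testDeriv Ω α φ)
  map_add' φ ψ := by
    ext1 α
    simp
  map_smul' c φ := by
    ext1 α
    simp

/-- The Hilbert space `W^{2,2}_0(Ω)`: the completion of `C_c^∞(Ω)` in the `W^{2,2}(Ω)`-norm,
realized as a closed subspace of `∏_{|α| ≤ 2} L²(Ω)`. An element is the family of all weak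
derivatives of order at most two of a function (see `integral_component_mul_test`), which it
is therefore identified with. -/
def sobolevZero (Ω : Opens Plane) : Submodule ℝ (Jets Ω) :=
  (LinearMap.range (jet Ω)).topologicalClosure

/-- `W^{2,2}_0(Ω)` as a normed space, with the `W^{2,2}(Ω)`-norm. -/
abbrev W022 (Ω : Opens Plane) : Type := sobolevZero Ω

variable {Ω : Opens Plane}

namespace W022

/-- The function `u ∈ L²(Ω)` itself. -/
def val (u : W022 Ω) : L2 Ω := (u : Jets Ω) ⟨(0, 0), by decide⟩

/-- The weak derivative `u_{x₁}`. -/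
def d1 (u : W022 Ω) : L2 Ω := (u : Jets Ω) ⟨(1, 0), by decide⟩

/-- The weak derivative `u_{x₂}`. -/
def d2 (u : W022 Ω) : L2 Ω := (u : Jets Ω) ⟨(0, 1), by decide⟩

/-- The weak derivative `u_{x₁ x₁}`. -/
def d11 (u : W022 Ω) : L2 Ω := (u : Jets Ω) ⟨(2, 0), by decide⟩

/-- The weak derivative `u_{x₁ x₂}`. -/
def d12 (u : W022 Ω) : L2 Ω := (u : Jets Ω) ⟨(1, 1), by decide⟩

/-- The weak derivative `u_{x₂ x₂}`. -/
def d22 (u : W022 Ω) : L2 Ω := (u : Jets Ω) ⟨(0, 2), by decide⟩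

end W022

/-- The energy functional
`J_lam(u) = ½ ∫_Ω |Δu|² - ∫_Ω u_{x₁} u_{x₂} u_{x₁x₂} - lam ∫_Ω f u` on `W^{2,2}_0(Ω)`. -/
def energy (Ω : Opens Plane) (f : Plane → ℝ) (lam : ℝ) (u : W022 Ω) : ℝ :=
  (1 / 2) * (∫ x in (Ω : Set Plane), |u.d11 x + u.d22 x| ^ 2)
    - (∫ x in (Ω : Set Plane), u.d1 x * u.d2 x * u.d12 x)
    - lam * ∫ x in (Ω : Set Plane), f x * u.val x

/-- Palais-Smale sequences of a functional `J` on a real normed space `X` to the level `c`: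
`J(u_k) → c`, and `J'(u_k) → 0` in the norm of the dual of `X`. (For `X = W^{2,2}_0(Ω)` the
dual is `W^{-2,2}(Ω)`.) -/
def IsPalaisSmale {X : Type*} [NormedAddCommGroup X] [NormedSpace ℝ X] (J : X → ℝ) (c : ℝ)
    (u : ℕ → X) : Prop :=
  Tendsto (fun k => J (u k)) atTop (𝓝 c) ∧
    Tendsto (fun k => fderiv ℝ J (u k)) atTop (𝓝 (0 : X →L[ℝ] ℝ))

/-! The components of an element of `W^{2,2}_0(Ω)` are the weak derivatives of the first one. -/

theorem setIntegral_test_mul (φ ψ : 𝓓(Ω, ℝ)) :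
    ∫ x in (Ω : Set Plane), φ x * ψ x = ∫ x, φ x * ψ x := by
  apply setIntegral_eq_integral_of_forall_compl_eq_zero
  intro x hx
  have : φ x = 0 := image_eq_zero_of_notMem_tsupport fun h => hx (φ.tsupport_subset h)
  simp [this]

theorem integrable_test_mul (φ ψ : 𝓓(Ω, ℝ)) : Integrable (fun x => φ x * ψ x) volume :=
  (φ.continuous.mul ψ.continuous).integrable_of_hasCompactSupport φ.hasCompactSupport.mul_right

theorem integral_dirDeriv_mul (v : Plane) (φ ψ : 𝓓(Ω, ℝ)) :
    ∫ x in (Ω : Set Plane), dirDeriv Ω v φ x * ψ x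
      = -∫ x in (Ω : Set Plane), φ x * dirDeriv Ω v ψ x := by
  rw [setIntegral_test_mul, setIntegral_test_mul, eq_neg_iff_add_eq_zero, add_comm,
    ← eq_neg_iff_add_eq_zero]
  exact integral_mul_fderiv_eq_neg_fderiv_mul_of_integrable
    (integrable_test_mul (dirDeriv Ω v φ) ψ) (integrable_test_mul φ (dirDeriv Ω v ψ))
    (integrable_test_mul φ ψ) (fun x _ => φ.contDiff.differentiable (by simp) x)
    (fun x _ => ψ.contDiff.differentiable (by simp) x)

theorem integral_dirDeriv_pow_mul (v : Plane) (n : ℕ) (φ ψ : 𝓓(Ω, ℝ)) :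
    ∫ x in (Ω : Set Plane), ((dirDeriv Ω v) ^ n) φ x * ψ x
      = (-1) ^ n * ∫ x in (Ω : Set Plane), φ x * ((dirDeriv Ω v) ^ n) ψ x := by
  induction n generalizing φ with
  | zero => simp
  | succ n ih =>
    have h1 : ((dirDeriv Ω v) ^ (n + 1)) φ = ((dirDeriv Ω v) ^ n) (dirDeriv Ω v φ) := by
      rw [pow_succ]; rfl
    have h2 : ((dirDeriv Ω v) ^ (n + 1)) ψ = dirDeriv Ω v (((dirDeriv Ω v) ^ n) ψ) := by
      rw [pow_succ']; rfl
    rw [h1, h2, ih, integral_dirDeriv_mul]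
    ring

/-- `∫_Ω u_α ψ = (-1)^{|α|} ∫_Ω u ∂₂^{α₂} ∂₁^{α₁} ψ` for all `u ∈ W^{2,2}_0(Ω)` and all test
functions `ψ`, that is, `u_α` is the weak derivative `∂^α u`. -/
theorem integral_component_mul_test (u : W022 Ω) (α : MultiIndex) (ψ : 𝓓(Ω, ℝ)) :
    ∫ x in (Ω : Set Plane), (u : Jets Ω) α x * ψ x
      = (-1) ^ ((α.1.1 : ℕ) + (α.1.2 : ℕ)) * ∫ x in (Ω : Set Plane), u.val x *
          ((dirDeriv Ω (0, 1)) ^ (α.1.2 : ℕ)) (((dirDeriv Ω (1, 0)) ^ (α.1.1 : ℕ)) ψ) x := by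
  have key : ∀ (w : L2 Ω) (θ : 𝓓(Ω, ℝ)),
      ∫ x in (Ω : Set Plane), w x * θ x = inner ℝ (testToL2 Ω θ) w := by
    intro w θ
    rw [L2.inner_def]
    apply integral_congr_ae
    filter_upwards [(memLp_test Ω θ).coeFn_toLp] with x hx
    change _ = w x * (((memLp_test Ω θ).toLp θ : L2 Ω) x)
    rw [hx]
  have hcl : IsClosed {U : Jets Ω | inner ℝ (testToL2 Ω ψ) (U α)
      = (-1) ^ ((α.1.1 : ℕ) + (α.1.2 : ℕ)) * inner ℝ (testToL2 Ω
          (((dirDeriv Ω (0, 1)) ^ (α.1.2 : ℕ)) (((dirDeriv Ω (1, 0)) ^ (α.1.1 : ℕ)) ψ)))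
          (U ⟨(0, 0), by decide⟩)} := by
    apply isClosed_eq <;> fun_prop
  rw [key, key]
  refine closure_minimal (t := {U : Jets Ω | inner ℝ (testToL2 Ω ψ) (U α)
      = (-1) ^ ((α.1.1 : ℕ) + (α.1.2 : ℕ)) * inner ℝ (testToL2 Ω
          (((dirDeriv Ω (0, 1)) ^ (α.1.2 : ℕ)) (((dirDeriv Ω (1, 0)) ^ (α.1.1 : ℕ)) ψ)))
          (U ⟨(0, 0), by decide⟩)}) ?_ hcl u.2
  rintro _ ⟨φ, rfl⟩
  rw [mem_ofPred_eq]
  have h : ∀ θ η : 𝓓(Ω, ℝ), inner ℝ (testToL2 Ω θ) (testToL2 Ω η)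
      = ∫ x in (Ω : Set Plane), η x * θ x := by
    intro θ η
    rw [← key]
    apply integral_congr_ae
    filter_upwards [(memLp_test Ω η).coeFn_toLp] with x hx
    change ((memLp_test Ω η).toLp η : L2 Ω) x * _ = _
    rw [hx]
  have h0 : (jet Ω φ) ⟨(0, 0), by decide⟩ = testToL2 Ω φ := by
    simp [jet, testDeriv]
  have h1 : (jet Ω φ) α = testToL2 Ω (testDeriv Ω α φ) := rfl
  rw [h0, h1, h, h]
  change ∫ x in (Ω : Set Plane), ((dirDeriv Ω (1, 0)) ^ (α.1.1 : ℕ))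
    (((dirDeriv Ω (0, 1)) ^ (α.1.2 : ℕ)) φ) x * ψ x = _
  rw [integral_dirDeriv_pow_mul, integral_dirDeriv_pow_mul]
  ring

end EpitaxialGrowth

end

/-!
The Fréchet derivative of the energy at `u`, applied to `h`, is
`∫ Δu Δh - ∫ (h₁ u₂ u₁₂ + u₁ h₂ u₁₂ + u₁ u₂ h₁₂) - lam ∫ f h`. Taking the difference of the
derivatives at two members `u`, `v` of a Palais-Smale sequence and testing it with `h = u - v`, the
term with `f` cancels, `‖Δh‖²` appears, and every cubic term has a factor `h₁` or `h₂`, measured in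
`L⁴`, against bounded factors (`norm_sq_sub_le`). So `‖Δ(u - v)‖` is small as soon as the gradients
are close in `L⁴`, and `‖Δh‖` controls the full norm (`W022.antilipschitz_laplacian`). What remains
is that bounded sequences have subsequences whose gradients are Cauchy in `L⁴`.

This compactness needs only elementary facts about test functions. Integrating `φ₁₂` over rectangles
shows that `φ` is bounded and Hölder continuous with constants controlled by `‖φ₁₂‖`
(`abs_test_le`, `abs_sub_le_sqrt_dist`), so by Arzelà–Ascoli a bounded sequence has a uniformly
Cauchy subsequence (`exists_subseq_uniformCauchy`). The identity `∫ φ₁⁴ = -3 ∫ φ φ₁² φ₁₁` gives the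
interpolation inequality `‖φ₁‖²_{L⁴} ≤ 3 ‖φ‖_∞ ‖φ₁₁‖_{L²}` (`eLpNorm_dirDeriv_le`), which turns
uniform convergence into convergence of the gradients in `L⁴`.

The same inequalities, extended by density, give the embeddings of `W^{2,2}_0(Ω)` into `L^∞(Ω)` and
of its gradients into `L⁴(Ω)`; they are what makes the energy finite and differentiable, since
through them it is the sum of a quadratic, a trilinear and a linear bounded form (`energy_eq`).
-/

namespace EpitaxialGrowth

variable {Ω : Opens Plane}

/-! ### Estimates for test functions -/

theorem coeFn_testToL2 (φ : 𝓓(Ω, ℝ)) :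
    (testToL2 Ω φ : Plane → ℝ) =ᵐ[volume.restrict (Ω : Set Plane)] φ :=
  (memLp_test Ω φ).coeFn_toLp

theorem inner_testToL2 (φ ψ : 𝓓(Ω, ℝ)) :
    inner ℝ (testToL2 Ω φ) (testToL2 Ω ψ) = ∫ x in (Ω : Set Plane), φ x * ψ x := by
  rw [L2.inner_def]
  apply integral_congr_ae
  filter_upwards [coeFn_testToL2 φ, coeFn_testToL2 ψ] with x hx hy
  rw [hx, hy]
  simp [mul_comm]

theorem dirDeriv_apply (v : Plane) (φ : 𝓓(Ω, ℝ)) (x : Plane) :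
    dirDeriv Ω v φ x = fderiv ℝ φ x v := rfl

theorem dirDeriv_comm (v w : Plane) (φ : 𝓓(Ω, ℝ)) :
    dirDeriv Ω v (dirDeriv Ω w φ) = dirDeriv Ω w (dirDeriv Ω v φ) := by
  ext x
  have hd : DifferentiableAt ℝ (fderiv ℝ φ) x :=
    ((φ.contDiff.fderiv_right (m := ∞) le_rfl).differentiable (by simp)) x
  have key : ∀ a b : Plane, dirDeriv Ω a (dirDeriv Ω b φ) x = fderiv ℝ (fderiv ℝ φ) x a b := by
    intro a b
    change fderiv ℝ (fun y => fderiv ℝ φ y b) x a = _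
    rw [fderiv_clm_apply hd (differentiableAt_const b)]
    simp
  rw [key, key]
  have hs : minSmoothness ℝ 2 ≤ (∞ : ℕ∞ω) := by
    rw [minSmoothness_of_isRCLikeNormedField]
    exact WithTop.coe_le_coe.2 le_top
  exact (φ.contDiff.contDiffAt.isSymmSndFDerivAt hs) v w

/-- Integrating by parts twice turns `∫ φ_{vw}²` into `∫ φ_{vv} φ_{ww}`; this is what makes the
Laplacian control the full Hessian. -/
theorem norm_sq_mixed_deriv (v w : Plane) (φ : 𝓓(Ω, ℝ)) :
    ‖testToL2 Ω (dirDeriv Ω v (dirDeriv Ω w φ))‖ ^ 2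
      = inner ℝ (testToL2 Ω (dirDeriv Ω v (dirDeriv Ω v φ)))
          (testToL2 Ω (dirDeriv Ω w (dirDeriv Ω w φ))) := by
  rw [← real_inner_self_eq_norm_sq, real_inner_comm (testToL2 Ω (dirDeriv Ω w (dirDeriv Ω w φ))),
    inner_testToL2, inner_testToL2, integral_dirDeriv_mul v (dirDeriv Ω w φ),
    integral_dirDeriv_mul w (dirDeriv Ω w φ),
    dirDeriv_comm w v (dirDeriv Ω v φ), dirDeriv_comm w v φ]

theorem norm_sq_dirDeriv_le (v : Plane) (φ : 𝓓(Ω, ℝ)) :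
    ‖testToL2 Ω (dirDeriv Ω v φ)‖ ^ 2
      ≤ ‖testToL2 Ω φ‖ * ‖testToL2 Ω (dirDeriv Ω v (dirDeriv Ω v φ))‖ := by
  rw [← real_inner_self_eq_norm_sq, inner_testToL2, integral_dirDeriv_mul, ← inner_testToL2]
  exact (neg_le_abs _).trans (abs_real_inner_le_norm _ _)

theorem intervalIntegral_mixed_deriv (φ : 𝓓(Ω, ℝ)) (a b c d : ℝ) :
    ∫ x in a..b, ∫ y in c..d, dirDeriv Ω (0, 1) (dirDeriv Ω (1, 0) φ) (x, y)
      = φ (b, d) - φ (b, c) - (φ (a, d) - φ (a, c)) := by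
  have h1 : ∀ (ψ : 𝓓(Ω, ℝ)) (x y : ℝ),
      HasDerivAt (fun s => ψ (s, y)) (dirDeriv Ω (1, 0) ψ (x, y)) x := by
    intro ψ x y
    have := (ψ.contDiff.differentiable (by simp) (x, y)).hasFDerivAt
    exact this.comp_hasDerivAt x ((hasDerivAt_id x).prodMk (hasDerivAt_const x y))
  have h2 : ∀ (ψ : 𝓓(Ω, ℝ)) (x y : ℝ),
      HasDerivAt (fun s => ψ (x, s)) (dirDeriv Ω (0, 1) ψ (x, y)) y := by
    intro ψ x y
    have := (ψ.contDiff.differentiable (by simp) (x, y)).hasFDerivAt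
    exact this.comp_hasDerivAt y ((hasDerivAt_const y x).prodMk (hasDerivAt_id y))
  have hi : ∀ (ψ : 𝓓(Ω, ℝ)) (x : ℝ), Continuous fun y => ψ (x, y) := fun ψ x =>
    ψ.continuous.comp (by fun_prop)
  have hi' : ∀ (ψ : 𝓓(Ω, ℝ)) (y : ℝ), Continuous fun x => ψ (x, y) := fun ψ y =>
    ψ.continuous.comp (by fun_prop)
  have hin : ∀ x, ∫ y in c..d, dirDeriv Ω (0, 1) (dirDeriv Ω (1, 0) φ) (x, y)
      = dirDeriv Ω (1, 0) φ (x, d) - dirDeriv Ω (1, 0) φ (x, c) := fun x =>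
    intervalIntegral.integral_eq_sub_of_hasDerivAt (fun y _ => h2 _ x y)
      ((hi _ x).intervalIntegrable _ _)
  simp_rw [hin]
  rw [intervalIntegral.integral_eq_sub_of_hasDerivAt
      (f := fun x => φ (x, d) - φ (x, c)) (fun x _ => (h1 φ x d).sub (h1 φ x c))
      (((hi' _ d).sub (hi' _ c)).intervalIntegrable _ _)]

/-- The second difference of `φ` over a rectangle is the integral of `φ_{x₁x₂}` over it, hence is
bounded by the square root of the area times `‖φ_{x₁x₂}‖_{L²}`. -/
theorem abs_second_difference_le (φ : 𝓓(Ω, ℝ)) {a b c d : ℝ} (hab : a ≤ b) (hcd : c ≤ d) :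
    |φ (b, d) - φ (b, c) - (φ (a, d) - φ (a, c))|
      ≤ √((b - a) * (d - c)) * ‖testToL2 Ω (dirDeriv Ω (1, 0) (dirDeriv Ω (0, 1) φ))‖ := by
  rw [← intervalIntegral_mixed_deriv, dirDeriv_comm]
  set ψ := dirDeriv Ω (1, 0) (dirDeriv Ω (0, 1) φ)
  have hψ : MemLp ψ 2 (volume : Measure Plane) :=
    ψ.continuous.memLp_of_hasCompactSupport ψ.hasCompactSupport
  have hfin : (volume : Measure Plane) (Ioc a b ×ˢ Ioc c d) ≠ ⊤ := by
    rw [Measure.volume_eq_prod, Measure.prod_prod]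
    exact ENNReal.mul_ne_top (by simp) (by simp)
  have hms : MeasurableSet (Ioc a b ×ˢ Ioc c d) := measurableSet_Ioc.prod measurableSet_Ioc
  have hint : Integrable ψ (volume : Measure Plane) :=
    ψ.continuous.integrable_of_hasCompactSupport ψ.hasCompactSupport
  have e1 : ∫ x in a..b, ∫ y in c..d, ψ (x, y) = ∫ z in Ioc a b ×ˢ Ioc c d, ψ z := by
    simp_rw [intervalIntegral.integral_of_le hab, intervalIntegral.integral_of_le hcd]
    rw [Measure.volume_eq_prod] at hint ⊢
    rw [setIntegral_prod _ hint.integrableOn]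
  have e2 : ∫ z in Ioc a b ×ˢ Ioc c d, ψ z
      = inner ℝ (indicatorConstLp 2 hms hfin (1 : ℝ)) (hψ.toLp ψ) := by
    rw [L2.inner_indicatorConstLp_one]
    exact setIntegral_congr_ae hms (hψ.coeFn_toLp.mono fun x hx _ => hx.symm)
  have e3 : ‖hψ.toLp ψ‖ = ‖testToL2 Ω ψ‖ := by
    rw [← sq_eq_sq₀ (norm_nonneg _) (norm_nonneg _), ← real_inner_self_eq_norm_sq,
      ← real_inner_self_eq_norm_sq, inner_testToL2, setIntegral_test_mul, L2.inner_def]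
    apply integral_congr_ae
    filter_upwards [hψ.coeFn_toLp] with x hx
    rw [hx]
    rfl
  rw [e1, e2, ← e3]
  refine (abs_real_inner_le_norm _ _).trans_eq ?_
  congr 1
  rw [norm_indicatorConstLp (by simp) (by simp)]
  simp [Measure.real, Measure.volume_eq_prod, Measure.prod_prod, Real.sqrt_eq_rpow, hab, hcd]

theorem test_eq_zero (φ : 𝓓(Ω, ℝ)) {x : Plane} (hx : x ∉ Ω) : φ x = 0 :=
  image_eq_zero_of_notMem_tsupport fun h => hx (φ.tsupport_subset h)

section Box

variable {R : ℝ} (hR : (Ω : Set Plane) ⊆ Ioo (-R) R ×ˢ Ioo (-R) R)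
include hR

/-- Comparing with a point of the side `x₂ = -R`, where `φ` vanishes, the second difference becomes
a difference in the direction of `x₁`. -/
theorem abs_sub_le_fst (φ : 𝓓(Ω, ℝ)) {a b d : ℝ} (hab : a ≤ b) (hd : d ∈ Icc (-R) R) :
    |φ (b, d) - φ (a, d)|
      ≤ √(2 * R * (b - a)) * ‖testToL2 Ω (dirDeriv Ω (1, 0) (dirDeriv Ω (0, 1) φ))‖ := by
  have h := abs_second_difference_le φ hab hd.1
  have hz : ∀ s : ℝ, φ (s, -R) = 0 := fun s =>
    test_eq_zero φ fun hs => lt_irrefl _ (hR hs).2.1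
  rw [hz, hz, sub_zero, sub_zero] at h
  refine h.trans (mul_le_mul_of_nonneg_right (Real.sqrt_le_sqrt ?_) (norm_nonneg _))
  nlinarith [hd.1, hd.2]

/-- The counterpart of `abs_sub_le_fst` in the direction of `x₂`, from the side `x₁ = -R`. -/
theorem abs_sub_le_snd (φ : 𝓓(Ω, ℝ)) {b c d : ℝ} (hcd : c ≤ d) (hb : b ∈ Icc (-R) R) :
    |φ (b, d) - φ (b, c)|
      ≤ √(2 * R * (d - c)) * ‖testToL2 Ω (dirDeriv Ω (1, 0) (dirDeriv Ω (0, 1) φ))‖ := by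
  have h := abs_second_difference_le φ hb.1 hcd
  have hz : ∀ s : ℝ, φ (-R, s) = 0 := fun s =>
    test_eq_zero φ fun hs => lt_irrefl _ (hR hs).1.1
  rw [hz, hz, sub_zero, sub_zero] at h
  refine h.trans (mul_le_mul_of_nonneg_right (Real.sqrt_le_sqrt ?_) (norm_nonneg _))
  nlinarith [hb.1, hb.2]

theorem abs_test_le (φ : 𝓓(Ω, ℝ)) (x : Plane) :
    |φ x| ≤ 2 * |R| * ‖testToL2 Ω (dirDeriv Ω (1, 0) (dirDeriv Ω (0, 1) φ))‖ := by
  by_cases hx : x ∈ Ω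
  · obtain ⟨⟨h1, h2⟩, h3, h4⟩ := hR hx
    have h := abs_sub_le_fst hR φ h1.le ⟨h3.le, h4.le⟩
    rw [test_eq_zero φ (x := (-R, x.2)) (fun hs => lt_irrefl _ (hR hs).1.1), sub_zero] at h
    refine h.trans (mul_le_mul_of_nonneg_right (Real.sqrt_le_iff.2 ⟨by positivity, ?_⟩)
      (norm_nonneg _))
    rw [mul_pow, sq_abs]
    nlinarith
  · rw [test_eq_zero φ hx, abs_zero]
    positivity

theorem abs_sub_le_sqrt_dist (φ : 𝓓(Ω, ℝ)) {x y : Plane} (hx : x ∈ Icc (-R, -R) (R, R))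
    (hy : y ∈ Icc (-R, -R) (R, R)) :
    |φ x - φ y| ≤ 2 * √(2 * R * dist x y)
      * ‖testToL2 Ω (dirDeriv Ω (1, 0) (dirDeriv Ω (0, 1) φ))‖ := by
  set N := ‖testToL2 Ω (dirDeriv Ω (1, 0) (dirDeriv Ω (0, 1) φ))‖
  have hN : 0 ≤ N := norm_nonneg _
  have hR0 : 0 ≤ R := by linarith [hx.1.1, hx.2.1]
  have h1 : |φ (x.1, x.2) - φ (y.1, x.2)| ≤ √(2 * R * dist x y) * N := by
    have hd : |x.1 - y.1| ≤ dist x y := le_max_left _ _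
    have hm : x.2 ∈ Icc (-R) R := ⟨hx.1.2, hx.2.2⟩
    rcases le_total x.1 y.1 with h | h
    · rw [abs_sub_comm]
      refine (abs_sub_le_fst hR φ h hm).trans (mul_le_mul_of_nonneg_right (Real.sqrt_le_sqrt
        (mul_le_mul_of_nonneg_left ?_ (by positivity))) hN)
      linarith [neg_abs_le (x.1 - y.1)]
    · refine (abs_sub_le_fst hR φ h hm).trans (mul_le_mul_of_nonneg_right (Real.sqrt_le_sqrt
        (mul_le_mul_of_nonneg_left ?_ (by positivity))) hN)
      linarith [le_abs_self (x.1 - y.1)]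
  have h2 : |φ (y.1, x.2) - φ (y.1, y.2)| ≤ √(2 * R * dist x y) * N := by
    have hd : |x.2 - y.2| ≤ dist x y := le_max_right _ _
    have hm : y.1 ∈ Icc (-R) R := ⟨hy.1.1, hy.2.1⟩
    rcases le_total x.2 y.2 with h | h
    · rw [abs_sub_comm]
      refine (abs_sub_le_snd hR φ h hm).trans (mul_le_mul_of_nonneg_right (Real.sqrt_le_sqrt
        (mul_le_mul_of_nonneg_left ?_ (by positivity))) hN)
      linarith [neg_abs_le (x.2 - y.2)]
    · refine (abs_sub_le_snd hR φ h hm).trans (mul_le_mul_of_nonneg_right (Real.sqrt_le_sqrt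
        (mul_le_mul_of_nonneg_left ?_ (by positivity))) hN)
      linarith [le_abs_self (x.2 - y.2)]
  have := abs_sub_le (φ (x.1, x.2)) (φ (y.1, x.2)) (φ (y.1, y.2))
  change |φ (x.1, x.2) - φ (y.1, y.2)| ≤ _
  linarith

/-- Test functions with bounded mixed derivative in `L²` are bounded and uniformly Hölder
continuous, so the Arzelà–Ascoli theorem applies to them. -/
theorem exists_subseq_uniformCauchy (φ : ℕ → 𝓓(Ω, ℝ)) {B : ℝ}
    (hB : ∀ k, ‖testToL2 Ω (dirDeriv Ω (1, 0) (dirDeriv Ω (0, 1) (φ k)))‖ ≤ B) :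
    ∃ g : ℕ → ℕ, StrictMono g ∧ ∀ ε > 0, ∃ N, ∀ m ≥ N, ∀ n ≥ N, ∀ x,
      |φ (g m) x - φ (g n) x| ≤ ε := by
  let K : Set Plane := Icc (-R, -R) (R, R)
  have : CompactSpace K := isCompact_iff_compactSpace.1 isCompact_Icc
  let F : ℕ → BoundedContinuousFunction K ℝ := fun k =>
    BoundedContinuousFunction.mkOfCompact ⟨fun x => φ k x, (φ k).continuous.comp (by fun_prop)⟩
  have hcomp : IsCompact (closure (range F)) := by
    refine BoundedContinuousFunction.arzela_ascoli (Metric.closedBall 0 (2 * |R| * B))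
      (isCompact_closedBall _ _) _ ?_ ?_
    · rintro _ x ⟨k, rfl⟩
      rw [mem_closedBall_zero_iff]
      exact (abs_test_le hR (φ k) x).trans (mul_le_mul_of_nonneg_left (hB k) (by positivity))
    · refine Metric.equicontinuous_of_continuity_modulus (fun t => 2 * √(2 * R * t) * B) ?_ _ ?_
      · have : Continuous fun t : ℝ => 2 * √(2 * R * t) * B := by fun_prop
        simpa using this.tendsto 0
      · rintro x y ⟨_, k, rfl⟩
        exact (abs_sub_le_sqrt_dist hR (φ k) x.2 y.2).trans
          (mul_le_mul_of_nonneg_left (hB k) (by positivity))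
  obtain ⟨w, -, g, hg, hw⟩ := hcomp.tendsto_subseq fun k => subset_closure (mem_range_self k)
  refine ⟨g, hg, fun ε hε => ?_⟩
  obtain ⟨N, hN⟩ := Metric.cauchySeq_iff.1 hw.cauchySeq ε hε
  refine ⟨N, fun m hm n hn x => ?_⟩
  by_cases hx : x ∈ Ω
  · have hxK : x ∈ K := ⟨⟨(hR hx).1.1.le, (hR hx).2.1.le⟩, ⟨(hR hx).1.2.le, (hR hx).2.2.le⟩⟩
    exact (BoundedContinuousFunction.dist_coe_le_dist (f := F (g m)) (g := F (g n)) ⟨x, hxK⟩).trans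
      (hN m hm n hn).le
  · rw [test_eq_zero _ hx, test_eq_zero _ hx, sub_zero, abs_zero]
    exact hε.le

end Box

theorem integrable_test_mul_continuous (φ : 𝓓(Ω, ℝ)) {g : Plane → ℝ} (hg : Continuous g) :
    Integrable (fun x => φ x * g x) volume :=
  (φ.continuous.mul hg).integrable_of_hasCompactSupport φ.hasCompactSupport.mul_right

/-- Since `∫ φ_v⁴ = -3 ∫ φ φ_v² φ_{vv}`, a uniform bound on `φ` and an `L²` bound on `φ_{vv}` give an
`L⁴` bound on `φ_v`. -/
theorem integral_dirDeriv_pow_four_le (v : Plane) (φ : 𝓓(Ω, ℝ)) {M : ℝ} (hM : ∀ x, |φ x| ≤ M) :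
    ∫ x in (Ω : Set Plane), dirDeriv Ω v φ x ^ 4
      ≤ (3 * M * ‖testToL2 Ω (dirDeriv Ω v (dirDeriv Ω v φ))‖) ^ 2 := by
  set ψ := dirDeriv Ω v φ with hψ
  set χ := dirDeriv Ω v ψ with hχ
  have hcφ := φ.continuous
  have hcψ := ψ.continuous
  have hcχ := χ.continuous
  have h4 : ∫ x in (Ω : Set Plane), ψ x ^ 4 = ∫ x, ψ x ^ 4 := by
    apply setIntegral_eq_integral_of_forall_compl_eq_zero
    intro x hx
    simp [test_eq_zero ψ hx]
  have hd : ∀ x, HasFDerivAt (fun y => ψ y ^ 3) ((3 * ψ x ^ 2) • fderiv ℝ ψ x) x := fun x => by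
    simpa using (ψ.contDiff.differentiable (by simp) x).hasFDerivAt.pow 3
  have hfd : ∀ x, fderiv ℝ (fun y => ψ y ^ 3) x v = 3 * ψ x ^ 2 * χ x := fun x => by
    rw [(hd x).fderiv]
    rfl
  have i4 : Integrable (fun x => ψ x ^ 4) volume :=
    (integrable_test_mul_continuous ψ (hcψ.pow 3)).congr (.of_forall fun x => by simp; ring)
  have i2 : Integrable (fun x => χ x ^ 2) volume :=
    (integrable_test_mul_continuous χ hcχ).congr (.of_forall fun x => by simp; ring)
  have i3 : Integrable (fun x => φ x * fderiv ℝ (fun y => ψ y ^ 3) x v) volume := by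
    simp_rw [hfd]
    exact integrable_test_mul_continuous φ (by fun_prop)
  have parts : ∫ x, ψ x ^ 4 = -∫ x, φ x * fderiv ℝ (fun y => ψ y ^ 3) x v := by
    have := integral_mul_fderiv_eq_neg_fderiv_mul_of_integrable (μ := (volume : Measure Plane))
      (f := φ) (g := fun y => ψ y ^ 3) (v := v)
      (integrable_test_mul_continuous ψ (hcψ.pow 3)) i3
      (integrable_test_mul_continuous φ (hcψ.pow 3))
      (fun x _ => φ.contDiff.differentiable (by simp) x) (fun x _ => (hd x).differentiableAt)
    rw [this, neg_neg]
    exact integral_congr_ae (.of_forall fun x => by simp only [hψ, dirDeriv_apply]; ring)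
  have hχ2 : ‖testToL2 Ω χ‖ ^ 2 = ∫ x, χ x ^ 2 := by
    rw [← real_inner_self_eq_norm_sq, inner_testToL2, setIntegral_test_mul]
    exact integral_congr_ae (.of_forall fun x => by simp only; ring)
  -- Young's inequality absorbs half of the left-hand side
  have hle : ∫ x, ψ x ^ 4 ≤ ∫ x, (1 / 2 * ψ x ^ 4 + 9 / 2 * M ^ 2 * χ x ^ 2) := by
    rw [parts, ← integral_neg]
    refine integral_mono i3.neg ((i4.const_mul _).add (i2.const_mul _)) fun x => ?_
    simp only [hfd]
    have h1 : φ x ^ 2 ≤ M ^ 2 := sq_le_sq' (abs_le.1 (hM x)).1 (abs_le.1 (hM x)).2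
    nlinarith [sq_nonneg (ψ x ^ 2 + 3 * φ x * χ x), mul_le_mul_of_nonneg_right h1 (sq_nonneg (χ x))]
  rw [integral_add (i4.const_mul _) (i2.const_mul _), integral_const_mul, integral_const_mul,
    ← hχ2] at hle
  rw [h4, mul_pow, mul_pow]
  linarith

theorem eLpNorm_dirDeriv_le (v : Plane) (φ : 𝓓(Ω, ℝ)) {M : ℝ} (hM : ∀ x, |φ x| ≤ M) :
    eLpNorm (dirDeriv Ω v φ) 4 (volume.restrict (Ω : Set Plane))
      ≤ ENNReal.ofReal √(3 * M * ‖testToL2 Ω (dirDeriv Ω v (dirDeriv Ω v φ))‖) := by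
  have hM0 : 0 ≤ M := (abs_nonneg _).trans (hM 0)
  have hm : MemLp (dirDeriv Ω v φ) 4 (volume.restrict (Ω : Set Plane)) :=
    ((dirDeriv Ω v φ).continuous.memLp_of_hasCompactSupport
      (dirDeriv Ω v φ).hasCompactSupport).restrict _
  rw [hm.eLpNorm_eq_integral_rpow_norm (by simp) (by simp)]
  apply ENNReal.ofReal_le_ofReal
  have e : ∫ x in (Ω : Set Plane), ‖dirDeriv Ω v φ x‖ ^ (4 : ℝ≥0∞).toReal
      = ∫ x in (Ω : Set Plane), dirDeriv Ω v φ x ^ 4 := by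
    refine integral_congr_ae (.of_forall fun x => ?_)
    have : (4 : ℝ≥0∞).toReal = ((4 : ℕ) : ℝ) := by simp
    simp only [this, Real.rpow_natCast, Real.norm_eq_abs]
    exact Even.pow_abs (by decide) _
  rw [e]
  set A := 3 * M * ‖testToL2 Ω (dirDeriv Ω v (dirDeriv Ω v φ))‖ with hA
  have hA0 : 0 ≤ A := by positivity
  calc (∫ x in (Ω : Set Plane), dirDeriv Ω v φ x ^ 4) ^ ((4 : ℝ≥0∞).toReal)⁻¹
      ≤ (A ^ 2) ^ ((4 : ℝ≥0∞).toReal)⁻¹ :=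
        Real.rpow_le_rpow (integral_nonneg fun x => by positivity)
          (integral_dirDeriv_pow_four_le v φ hM) (by positivity)
    _ = √A := by
        rw [← Real.rpow_natCast, ← Real.rpow_mul hA0, Real.sqrt_eq_rpow]
        norm_num

/-! ### From test functions to `W^{2,2}_0(Ω)` -/

instance fact_one_le_four : Fact ((1 : ℝ≥0∞) ≤ 4) := ⟨by norm_num⟩

namespace W022

/-- A test function as an element of `W^{2,2}_0(Ω)`. -/
noncomputable def ofTest (Ω : Opens Plane) : 𝓓(Ω, ℝ) →ₗ[ℝ] W022 Ω :=
  (jet Ω).codRestrict (sobolevZero Ω) fun φ => subset_closure (LinearMap.mem_range_self _ φ)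

/-- The weak derivative `u ↦ ∂^α u` as a bounded operator into `L²(Ω)`. -/
noncomputable def component (α : MultiIndex) : W022 Ω →L[ℝ] L2 Ω :=
  (PiLp.proj 2 (fun _ : MultiIndex => L2 Ω) α).comp (sobolevZero Ω).subtypeL

theorem component_ofTest (α : MultiIndex) (φ : 𝓓(Ω, ℝ)) :
    component α (ofTest Ω φ) = testToL2 Ω (testDeriv Ω α φ) := rfl

theorem norm_component_le (α : MultiIndex) (u : W022 Ω) : ‖component α u‖ ≤ ‖u‖ :=
  PiLp.norm_apply_le (u : Jets Ω) α

/-- The Laplacian as a bounded operator into `L²(Ω)`. -/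
noncomputable def laplacian (Ω : Opens Plane) : W022 Ω →L[ℝ] L2 Ω :=
  component ⟨(2, 0), by decide⟩ + component ⟨(0, 2), by decide⟩

theorem denseRange_ofTest : DenseRange (ofTest Ω) := by
  intro u
  rw [closure_subtype]
  have : (Subtype.val '' range (ofTest Ω) : Set (Jets Ω)) = range (jet Ω) := by
    rw [← range_comp]; rfl
  rw [this]
  exact u.2

theorem norm_mixed_le (φ : 𝓓(Ω, ℝ)) :
    ‖testToL2 Ω (dirDeriv Ω (1, 0) (dirDeriv Ω (0, 1) φ))‖ ≤ ‖ofTest Ω φ‖ :=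
  norm_component_le ⟨(1, 1), by decide⟩ (ofTest Ω φ)

theorem norm_pure_fst_le (φ : 𝓓(Ω, ℝ)) :
    ‖testToL2 Ω (dirDeriv Ω (1, 0) (dirDeriv Ω (1, 0) φ))‖ ≤ ‖ofTest Ω φ‖ :=
  norm_component_le ⟨(2, 0), by decide⟩ (ofTest Ω φ)

theorem norm_pure_snd_le (φ : 𝓓(Ω, ℝ)) :
    ‖testToL2 Ω (dirDeriv Ω (0, 1) (dirDeriv Ω (0, 1) φ))‖ ≤ ‖ofTest Ω φ‖ :=
  norm_component_le ⟨(0, 2), by decide⟩ (ofTest Ω φ)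

/-- By Fatou's lemma along an almost everywhere convergent subsequence, an `L^p` bound on `∂^α φ` for
test functions `φ` extends to `W^{2,2}_0(Ω)`. -/
theorem eLpNorm_component_le {α : MultiIndex} {p : ℝ≥0∞} {C : ℝ}
    (h : ∀ φ, eLpNorm (testDeriv Ω α φ) p (volume.restrict (Ω : Set Plane))
      ≤ ENNReal.ofReal (C * ‖ofTest Ω φ‖)) (u : W022 Ω) :
    eLpNorm (component α u) p (volume.restrict (Ω : Set Plane)) ≤ ENNReal.ofReal (C * ‖u‖) := by
  obtain ⟨v, hv, hvu⟩ := mem_closure_iff_seq_limit.1 (denseRange_ofTest u)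
  choose φ hφ using hv
  have hL2 : Tendsto (fun n => component α (v n)) atTop (𝓝 (component α u)) :=
    ((component α).continuous.tendsto u).comp hvu
  obtain ⟨g, hg, hae⟩ := (tendstoInMeasure_of_tendsto_Lp hL2).exists_seq_tendsto_ae
  refine (Lp.eLpNorm_lim_le_liminf_eLpNorm (fun n => Lp.aestronglyMeasurable _) _ hae).trans ?_
  have hlim : Tendsto (fun n => ENNReal.ofReal (C * ‖v (g n)‖)) atTop
      (𝓝 (ENNReal.ofReal (C * ‖u‖))) :=
    ENNReal.tendsto_ofReal ((hvu.comp hg.tendsto_atTop).norm.const_mul C)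
  rw [← hlim.liminf_eq]
  refine liminf_le_liminf (.of_forall fun n => ?_)
  rw [← hφ, component_ofTest, eLpNorm_congr_ae (coeFn_testToL2 _)]
  exact h _

theorem exists_clm_Lp {α : MultiIndex} {p : ℝ≥0∞} [Fact (1 ≤ p)] {C : ℝ} (hC : 0 ≤ C)
    (h : ∀ φ, eLpNorm (testDeriv Ω α φ) p (volume.restrict (Ω : Set Plane))
      ≤ ENNReal.ofReal (C * ‖ofTest Ω φ‖)) :
    ∃ G : W022 Ω →L[ℝ] Lp ℝ p (volume.restrict (Ω : Set Plane)),
      ∀ u, (G u : Plane → ℝ) =ᵐ[volume.restrict (Ω : Set Plane)] component α u := by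
  have hm : ∀ u : W022 Ω, MemLp (component α u) p (volume.restrict (Ω : Set Plane)) := fun u =>
    ⟨Lp.aestronglyMeasurable _, (eLpNorm_component_le h u).trans_lt ENNReal.ofReal_lt_top⟩
  let G : W022 Ω →ₗ[ℝ] Lp ℝ p (volume.restrict (Ω : Set Plane)) :=
    { toFun := fun u => (hm u).toLp _
      map_add' := fun u v => by
        rw [← MemLp.toLp_add, MemLp.toLp_eq_toLp_iff, map_add]
        exact Lp.coeFn_add _ _
      map_smul' := fun c u => by
        rw [RingHom.id_apply, ← MemLp.toLp_const_smul, MemLp.toLp_eq_toLp_iff, map_smul]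
        exact Lp.coeFn_smul _ _ }
  refine ⟨G.mkContinuous C fun u => ?_, fun u => (hm u).coeFn_toLp⟩
  change ‖(hm u).toLp _‖ ≤ _
  rw [Lp.norm_toLp]
  exact ENNReal.toReal_le_of_le_ofReal (by positivity) (eLpNorm_component_le h u)

section Box

variable {R : ℝ} (hR : (Ω : Set Plane) ⊆ Ioo (-R) R ×ˢ Ioo (-R) R)
include hR

/-- The embedding `W^{2,2}_0(Ω) ⊂ L^∞(Ω)`. -/
theorem exists_val_clm :
    ∃ G : W022 Ω →L[ℝ] Lp ℝ ∞ (volume.restrict (Ω : Set Plane)),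
      ∀ u, (G u : Plane → ℝ) =ᵐ[volume.restrict (Ω : Set Plane)] u.val := by
  refine exists_clm_Lp (α := ⟨(0, 0), by decide⟩) (C := 2 * |R|) (by positivity) fun φ => ?_
  rw [eLpNorm_exponent_top]
  refine eLpNormEssSup_le_of_ae_bound (.of_forall fun x => ?_)
  exact (abs_test_le hR φ x).trans
    (mul_le_mul_of_nonneg_left (norm_mixed_le φ) (by positivity))

theorem eLpNorm_dirDeriv_le_norm (v : Plane) (φ : 𝓓(Ω, ℝ))
    (h : ‖testToL2 Ω (dirDeriv Ω v (dirDeriv Ω v φ))‖ ≤ ‖ofTest Ω φ‖) :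
    eLpNorm (dirDeriv Ω v φ) 4 (volume.restrict (Ω : Set Plane))
      ≤ ENNReal.ofReal (√(6 * |R|) * ‖ofTest Ω φ‖) := by
  refine (eLpNorm_dirDeriv_le v φ (abs_test_le hR φ)).trans (ENNReal.ofReal_le_ofReal ?_)
  rw [← Real.sqrt_sq (norm_nonneg (ofTest Ω φ)), ← Real.sqrt_mul (by positivity)]
  apply Real.sqrt_le_sqrt
  have := mul_le_mul (norm_mixed_le φ) h (norm_nonneg _) (norm_nonneg _)
  nlinarith [abs_nonneg R]

/-- The gradient of a function in `W^{2,2}_0(Ω)` is in `L⁴(Ω)`: first component. -/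
theorem exists_d1_clm :
    ∃ G : W022 Ω →L[ℝ] Lp ℝ 4 (volume.restrict (Ω : Set Plane)),
      ∀ u, (G u : Plane → ℝ) =ᵐ[volume.restrict (Ω : Set Plane)] u.d1 :=
  exists_clm_Lp (α := ⟨(1, 0), by decide⟩) (by positivity) fun φ =>
    eLpNorm_dirDeriv_le_norm hR (1, 0) φ (norm_pure_fst_le φ)

/-- The gradient of a function in `W^{2,2}_0(Ω)` is in `L⁴(Ω)`: second component. -/
theorem exists_d2_clm :
    ∃ G : W022 Ω →L[ℝ] Lp ℝ 4 (volume.restrict (Ω : Set Plane)),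
      ∀ u, (G u : Plane → ℝ) =ᵐ[volume.restrict (Ω : Set Plane)] u.d2 :=
  exists_clm_Lp (α := ⟨(0, 1), by decide⟩) (by positivity) fun φ =>
    eLpNorm_dirDeriv_le_norm hR (0, 1) φ (norm_pure_snd_le φ)

/-- The `L²` norm of the Laplacian is that of the full Hessian, by `norm_sq_mixed_deriv`; the
derivatives of lower order are bounded by the sup bound on `φ` and by `‖φ_i‖² ≤ ‖φ‖ ‖φ_{ii}‖`. -/
theorem norm_ofTest_le :
    ∃ C : ℝ, 0 ≤ C ∧ ∀ φ : 𝓓(Ω, ℝ), ‖ofTest Ω φ‖ ≤ C * ‖laplacian Ω (ofTest Ω φ)‖ := by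
  have hfin : IsFiniteMeasure (volume.restrict (Ω : Set Plane)) := by
    refine ⟨?_⟩
    rw [Measure.restrict_apply_univ]
    refine (measure_mono hR).trans_lt ?_
    rw [Measure.volume_eq_prod, Measure.prod_prod]
    exact ENNReal.mul_lt_top (by simp) (by simp)
  set c : ℝ := measureUnivNNReal (volume.restrict (Ω : Set Plane)) ^ ((2 : ℝ≥0∞).toReal)⁻¹
    * (2 * |R|) with hc
  have hc0 : 0 ≤ c := by positivity
  refine ⟨c + 1, by positivity, fun φ => ?_⟩
  set n := ‖testToL2 Ω φ‖ with hn
  set a := ‖testToL2 Ω (dirDeriv Ω (1, 0) (dirDeriv Ω (1, 0) φ))‖ with ha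
  set b := ‖testToL2 Ω (dirDeriv Ω (0, 1) (dirDeriv Ω (0, 1) φ))‖ with hb
  set m := ‖testToL2 Ω (dirDeriv Ω (1, 0) (dirDeriv Ω (0, 1) φ))‖ with hm
  have hLap : ‖laplacian Ω (ofTest Ω φ)‖ ^ 2 = a ^ 2 + 2 * m ^ 2 + b ^ 2 := by
    change ‖testToL2 Ω (dirDeriv Ω (1, 0) (dirDeriv Ω (1, 0) φ))
      + testToL2 Ω (dirDeriv Ω (0, 1) (dirDeriv Ω (0, 1) φ))‖ ^ 2 = _
    rw [norm_add_sq_real, ← norm_sq_mixed_deriv]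
  have hJet : ‖ofTest Ω φ‖ ^ 2 = n ^ 2 + ‖testToL2 Ω (dirDeriv Ω (1, 0) φ)‖ ^ 2
      + ‖testToL2 Ω (dirDeriv Ω (0, 1) φ)‖ ^ 2 + a ^ 2 + m ^ 2 + b ^ 2 := by
    change ‖jet Ω φ‖ ^ 2 = _
    rw [PiLp.norm_sq_eq_of_L2]
    have : (Finset.univ : Finset MultiIndex) = {⟨(0, 0), by decide⟩, ⟨(1, 0), by decide⟩,
      ⟨(0, 1), by decide⟩, ⟨(2, 0), by decide⟩, ⟨(1, 1), by decide⟩, ⟨(0, 2), by decide⟩} := by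
      decide
    rw [this]
    repeat rw [Finset.sum_insert (by decide)]
    rw [Finset.sum_singleton]
    simp only [← add_assoc]
    rfl
  have h0 : n ≤ c * m := by
    have := Lp.norm_le_of_ae_bound (f := testToL2 Ω φ) (C := 2 * |R| * m) (by positivity) (by
      filter_upwards [coeFn_testToL2 φ] with x hx
      rw [hx]
      exact abs_test_le hR φ x)
    rw [hc, mul_assoc]
    exact this
  have h1 := norm_sq_dirDeriv_le (1, 0) φ
  have h2 := norm_sq_dirDeriv_le (0, 1) φ
  rw [← hn, ← ha] at h1
  rw [← hn, ← hb] at h2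
  have hn0 : 0 ≤ n := norm_nonneg _
  have ha0 : 0 ≤ a := norm_nonneg _
  have hb0 : 0 ≤ b := norm_nonneg _
  have hm0 : 0 ≤ m := norm_nonneg _
  refine le_of_sq_le_sq ?_ (by positivity)
  rw [mul_pow, hLap, hJet]
  have e0 : n ^ 2 ≤ c ^ 2 * m ^ 2 := by
    rw [← mul_pow]; exact pow_le_pow_left₀ hn0 h0 2
  have e1 : n * a ≤ c * m * a := mul_le_mul_of_nonneg_right h0 ha0
  have e2 : n * b ≤ c * m * b := mul_le_mul_of_nonneg_right h0 hb0
  have e3 : c * m * a ≤ c * (m ^ 2 + a ^ 2) := by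
    rw [mul_assoc]; exact mul_le_mul_of_nonneg_left (by nlinarith) hc0
  have e4 : c * m * b ≤ c * (m ^ 2 + b ^ 2) := by
    rw [mul_assoc]; exact mul_le_mul_of_nonneg_left (by nlinarith) hc0
  have p1 : 0 ≤ c ^ 2 * (a ^ 2 + m ^ 2 + b ^ 2) := by positivity
  have p2 : 0 ≤ c * (a ^ 2 + 2 * m ^ 2 + b ^ 2) := by positivity
  nlinarith [sq_nonneg m]

/-- The norm of `W^{2,2}_0(Ω)` is controlled by the `L²` norm of the Laplacian. -/
theorem antilipschitz_laplacian : ∃ C, AntilipschitzWith C (laplacian Ω) := by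
  obtain ⟨C, hC0, hC⟩ := norm_ofTest_le hR
  refine ⟨⟨C, hC0⟩, (laplacian Ω).antilipschitz_of_bound fun u => ?_⟩
  exact denseRange_ofTest.induction_on u
    (isClosed_le continuous_norm (continuous_const.mul (laplacian Ω).continuous.norm)) hC

end Box

end W022

/-! ### Palais-Smale sequences of a quadratic functional with a trilinear perturbation -/

section Abstract

variable {H K L : Type*} [NormedAddCommGroup H] [NormedSpace ℝ H] [NormedAddCommGroup K]
  [InnerProductSpace ℝ K] [NormedAddCommGroup L] [NormedSpace ℝ L]
  (A D : H →L[ℝ] K) (G₁ G₂ : H →L[ℝ] L) (P : L →L[ℝ] L →L[ℝ] K) (F : H →L[ℝ] ℝ)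

theorem fderiv_quadratic_sub_trilinear_apply (u h : H) :
    fderiv ℝ (fun u => 1 / 2 * ‖A u‖ ^ 2 - inner ℝ (P (G₁ u) (G₂ u)) (D u) - F u) u h
      = inner ℝ (A u) (A h) - (inner ℝ (P (G₁ u) (G₂ u)) (D h)
          + inner ℝ (P (G₁ u) (G₂ h) + P (G₁ h) (G₂ u)) (D u)) - F h := by
  -- the function is differentiable, so `fderiv` is its derivative and not the default value `0`
  have h1 := (A.hasFDerivAt (x := u)).norm_sq.const_mul (1 / 2 : ℝ)
  have h2 := (P.hasFDerivAt_of_bilinear (G₁.hasFDerivAt (x := u)) (G₂.hasFDerivAt (x := u))).inner ℝ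
    (D.hasFDerivAt (x := u))
  have h3 := ((h1.sub h2).sub (F.hasFDerivAt (x := u))).fderiv
  refine (congrArg (fun T : H →L[ℝ] ℝ => T h) h3).trans ?_
  simp [fderivInnerCLM_apply]

/-- The derivatives at two points `u`, `v`, tested with `u - v`: the linear part cancels, and the
trilinear part carries a factor `G₁ (u - v)` or `G₂ (u - v)` in each of its terms. -/
theorem norm_sq_sub_le {B g d : ℝ} {u v : H} (hu : ‖u‖ ≤ B) (hv : ‖v‖ ≤ B)
    (h1u : ‖G₁ u‖ ≤ g) (h1v : ‖G₁ v‖ ≤ g) (h2u : ‖G₂ u‖ ≤ g) (h2v : ‖G₂ v‖ ≤ g)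
    (hdu : ‖D u‖ ≤ d) (hdv : ‖D v‖ ≤ d) :
    ‖A u - A v‖ ^ 2
      ≤ 2 * B * ‖fderiv ℝ (fun u => 1 / 2 * ‖A u‖ ^ 2 - inner ℝ (P (G₁ u) (G₂ u)) (D u) - F u) u
          - fderiv ℝ (fun u => 1 / 2 * ‖A u‖ ^ 2 - inner ℝ (P (G₁ u) (G₂ u)) (D u) - F u) v‖
        + 4 * ‖P‖ * g * d * (‖G₁ u - G₁ v‖ + ‖G₂ u - G₂ v‖) := by
  set Ju := fderiv ℝ (fun u => 1 / 2 * ‖A u‖ ^ 2 - inner ℝ (P (G₁ u) (G₂ u)) (D u) - F u) u with hJu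
  set Jv := fderiv ℝ (fun u => 1 / 2 * ‖A u‖ ^ 2 - inner ℝ (P (G₁ u) (G₂ u)) (D u) - F u) v with hJv
  have key : ‖A u - A v‖ ^ 2 = (Ju - Jv) (u - v)
      + (inner ℝ (P (G₁ u - G₁ v) (G₂ u)) (D (u - v)) + inner ℝ (P (G₁ v) (G₂ u - G₂ v)) (D (u - v)))
      + (inner ℝ (P (G₁ u) (G₂ u - G₂ v)) (D u) + inner ℝ (P (G₁ u - G₁ v) (G₂ u)) (D u))
      - (inner ℝ (P (G₁ v) (G₂ u - G₂ v)) (D v) + inner ℝ (P (G₁ u - G₁ v) (G₂ v)) (D v)) := by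
    rw [← real_inner_self_eq_norm_sq, sub_apply, hJu, hJv,
      fderiv_quadratic_sub_trilinear_apply, fderiv_quadratic_sub_trilinear_apply]
    simp only [map_sub, sub_apply, inner_sub_left, inner_sub_right,
      inner_add_left]
    ring
  have bound : ∀ {x y : L} {z : K} {x' y' z' : ℝ}, ‖x‖ ≤ x' → ‖y‖ ≤ y' → ‖z‖ ≤ z' →
      |inner ℝ (P x y) z| ≤ ‖P‖ * x' * y' * z' := by
    intro x y z x' y' z' hx hy hz
    have hx' := (norm_nonneg x).trans hx
    have hy' := (norm_nonneg y).trans hy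
    calc |inner ℝ (P x y) z| ≤ ‖P x y‖ * ‖z‖ := abs_real_inner_le_norm _ _
      _ ≤ (‖P‖ * ‖x‖ * ‖y‖) * ‖z‖ := by gcongr; exact P.le_opNorm₂ x y
      _ ≤ ‖P‖ * x' * y' * z' := by gcongr
  have hduv : ‖D (u - v)‖ ≤ 2 * d := by
    rw [map_sub]; exact (norm_sub_le _ _).trans (by linarith)
  have t1 := le_of_abs_le (bound le_rfl h2u hduv (x := G₁ u - G₁ v))
  have t2 := le_of_abs_le (bound h1v le_rfl hduv (y := G₂ u - G₂ v))
  have t3 := le_of_abs_le (bound h1u le_rfl hdu (y := G₂ u - G₂ v))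
  have t4 := le_of_abs_le (bound le_rfl h2u hdu (x := G₁ u - G₁ v))
  have t5 := neg_le_of_abs_le (bound h1v le_rfl hdv (y := G₂ u - G₂ v))
  have t6 := neg_le_of_abs_le (bound le_rfl h2v hdv (x := G₁ u - G₁ v))
  have t7 : (Ju - Jv) (u - v) ≤ ‖Ju - Jv‖ * (2 * B) := by
    refine (le_abs_self _).trans (((Ju - Jv).le_opNorm _).trans ?_)
    gcongr
    exact (norm_sub_le _ _).trans (by linarith)
  rw [key]
  linarith

/-- If the derivatives along a bounded sequence tend to `0` and the images under `G₁` and `G₂` are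
Cauchy, then so are the images under the quadratic part. -/
theorem cauchySeq_of_tendsto_fderiv {u : ℕ → H} {B : ℝ} (hB : ∀ k, ‖u k‖ ≤ B)
    (hJ : Tendsto (fun k => fderiv ℝ
      (fun u => 1 / 2 * ‖A u‖ ^ 2 - inner ℝ (P (G₁ u) (G₂ u)) (D u) - F u) (u k)) atTop (𝓝 0))
    (h₁ : CauchySeq fun k => G₁ (u k)) (h₂ : CauchySeq fun k => G₂ (u k)) :
    CauchySeq fun k => A (u k) := by
  have hB0 : 0 ≤ B := (norm_nonneg _).trans (hB 0)
  rw [cauchySeq_iff_tendsto_dist_atTop_0] at h₁ h₂ ⊢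
  have hJ' := cauchySeq_iff_tendsto_dist_atTop_0.1 hJ.cauchySeq
  have lim := ((hJ'.const_mul (2 * B)).add ((h₁.add h₂).const_mul
    (4 * ‖P‖ * ((‖G₁‖ + ‖G₂‖) * B) * (‖D‖ * B)))).sqrt
  simp only [add_zero, mul_zero, Real.sqrt_zero] at lim
  refine squeeze_zero (fun _ => dist_nonneg) (fun n => ?_) lim
  apply Real.le_sqrt_of_sq_le
  simp only [dist_eq_norm]
  have hb : ∀ (T : H →L[ℝ] L) k, ‖T (u k)‖ ≤ ‖T‖ * B := fun T k => T.le_opNorm_of_le (hB k)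
  have hg₁ : ‖G₁‖ * B ≤ (‖G₁‖ + ‖G₂‖) * B := by gcongr; linarith [norm_nonneg G₂]
  have hg₂ : ‖G₂‖ * B ≤ (‖G₁‖ + ‖G₂‖) * B := by gcongr; linarith [norm_nonneg G₁]
  exact norm_sq_sub_le A D G₁ G₂ P F (hB _) (hB _) ((hb G₁ _).trans hg₁) ((hb G₁ _).trans hg₁)
    ((hb G₂ _).trans hg₂) ((hb G₂ _).trans hg₂) (D.le_opNorm_of_le (hB _))
    (D.le_opNorm_of_le (hB _))

end Abstract

/-! ### The energy functional -/

instance holderTriple_four_four_two : ENNReal.HolderTriple 4 4 2 where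
  inv_add_inv_eq_inv := by
    rw [← ENNReal.toReal_eq_toReal_iff' (by simp) (by simp), ENNReal.toReal_add (by simp) (by simp)]
    norm_num

/-- The product `L⁴(Ω) × L⁴(Ω) → L²(Ω)`. -/
noncomputable def mulL4 (Ω : Opens Plane) :
    Lp ℝ 4 (volume.restrict (Ω : Set Plane)) →L[ℝ]
      Lp ℝ 4 (volume.restrict (Ω : Set Plane)) →L[ℝ] L2 Ω :=
  (ContinuousLinearMap.mul ℝ ℝ).holderL _ 4 4 2

/-- The energy as a sum of bounded forms. In particular the integrals in its definition converge on
all of `W^{2,2}_0(Ω)`, and it is Fréchet differentiable there. -/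
theorem energy_eq {f : Plane → ℝ} (hf : IntegrableOn f (Ω : Set Plane) volume) (lam : ℝ)
    {G₀ : W022 Ω →L[ℝ] Lp ℝ ∞ (volume.restrict (Ω : Set Plane))}
    {G₁ G₂ : W022 Ω →L[ℝ] Lp ℝ 4 (volume.restrict (Ω : Set Plane))}
    (h₀ : ∀ u, (G₀ u : Plane → ℝ) =ᵐ[volume.restrict (Ω : Set Plane)] u.val)
    (h₁ : ∀ u, (G₁ u : Plane → ℝ) =ᵐ[volume.restrict (Ω : Set Plane)] u.d1)
    (h₂ : ∀ u, (G₂ u : Plane → ℝ) =ᵐ[volume.restrict (Ω : Set Plane)] u.d2) :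
    energy Ω f lam = fun u => 1 / 2 * ‖W022.laplacian Ω u‖ ^ 2
      - inner ℝ (mulL4 Ω (G₁ u) (G₂ u)) (W022.component ⟨(1, 1), by decide⟩ u)
      - (lam • ((ContinuousLinearMap.mul ℝ ℝ).lpPairing _ 1 ∞
          ((memLp_one_iff_integrable.2 hf).toLp f)).comp G₀) u := by
  ext u
  rw [energy]
  congr 1
  · congr 1
    · rw [← real_inner_self_eq_norm_sq, L2.inner_def]
      congr 1
      apply integral_congr_ae
      filter_upwards [Lp.coeFn_add u.d11 u.d22] with x hx
      change _ = inner ℝ ((u.d11 + u.d22 : L2 Ω) x) ((u.d11 + u.d22 : L2 Ω) x)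
      rw [hx, sq_abs, real_inner_self_eq_norm_sq, Real.norm_eq_abs, sq_abs]
      rfl
    · rw [L2.inner_def]
      apply integral_congr_ae
      filter_upwards [(ContinuousLinearMap.mul ℝ ℝ).coeFn_holder (r := 2) (G₁ u) (G₂ u), h₁ u, h₂ u]
        with x hx hx1 hx2
      change _ = inner ℝ ((ContinuousLinearMap.mul ℝ ℝ).holder 2 (G₁ u) (G₂ u) x) (u.d12 x)
      rw [hx, hx1, hx2]
      simp [mul_comm]
  · change _ = lam * (ContinuousLinearMap.mul ℝ ℝ).lpPairing _ 1 ∞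
      ((memLp_one_iff_integrable.2 hf).toLp f) (G₀ u)
    rw [ContinuousLinearMap.lpPairing_eq_integral]
    congr 1
    apply integral_congr_ae
    filter_upwards [(memLp_one_iff_integrable.2 hf).coeFn_toLp, h₀ u] with x hx hx0
    rw [hx, hx0]
    rfl

/-! ### Compactness -/

/-- Uniform convergence of test functions bounded in `W^{2,2}_0(Ω)` gives convergence in `L⁴(Ω)` of
their first derivatives. -/
theorem cauchySeq_dirDeriv (v : Plane)
    {G : W022 Ω →L[ℝ] Lp ℝ 4 (volume.restrict (Ω : Set Plane))}
    (hG : ∀ φ, (G (W022.ofTest Ω φ) : Plane → ℝ)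
      =ᵐ[volume.restrict (Ω : Set Plane)] dirDeriv Ω v φ)
    (hv : ∀ φ, ‖testToL2 Ω (dirDeriv Ω v (dirDeriv Ω v φ))‖ ≤ ‖W022.ofTest Ω φ‖)
    {φ : ℕ → 𝓓(Ω, ℝ)} {B : ℝ} (hB : ∀ k, ‖W022.ofTest Ω (φ k)‖ ≤ B)
    (hφ : ∀ ε > 0, ∃ N, ∀ m ≥ N, ∀ n ≥ N, ∀ x, |φ m x - φ n x| ≤ ε) :
    CauchySeq fun k => G (W022.ofTest Ω (φ k)) := by
  have hB0 : 0 ≤ B := (norm_nonneg _).trans (hB 0)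
  rw [Metric.cauchySeq_iff]
  intro ε hε
  obtain ⟨δ, hδ, hδε⟩ : ∃ δ > 0, √(3 * δ * (2 * B)) < ε := by
    have hc : ContinuousAt (fun δ : ℝ => √(3 * δ * (2 * B))) 0 := by fun_prop
    have hs : Tendsto (fun δ : ℝ => √(3 * δ * (2 * B))) (𝓝[>] 0) (𝓝 0) := by
      simpa using hc.tendsto.mono_left nhdsWithin_le_nhds
    obtain ⟨δ, h1, h2⟩ := ((hs.eventually_lt_const hε).and self_mem_nhdsWithin).exists
    exact ⟨δ, h2, h1⟩
  obtain ⟨N, hN⟩ := hφ δ hδ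
  refine ⟨N, fun m hm n hn => lt_of_le_of_lt ?_ hδε⟩
  rw [dist_eq_norm, ← map_sub, ← map_sub, Lp.norm_def, eLpNorm_congr_ae (hG _)]
  refine ENNReal.toReal_le_of_le_ofReal (Real.sqrt_nonneg _)
    ((eLpNorm_dirDeriv_le v (φ m - φ n) (hN m hm n hn)).trans (ENNReal.ofReal_le_ofReal
      (Real.sqrt_le_sqrt (mul_le_mul_of_nonneg_left ((hv _).trans ?_) (by positivity)))))
  rw [map_sub]
  exact (norm_sub_le _ _).trans (by linarith [hB m, hB n])

/-- Sequences that approach each other have the same limits under a bounded operator. -/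
theorem cauchySeq_of_tendsto_sub {H L : Type*} [NormedAddCommGroup H] [NormedSpace ℝ H]
    [NormedAddCommGroup L] [NormedSpace ℝ L] [CompleteSpace L] (G : H →L[ℝ] L) {a b : ℕ → H}
    (hab : Tendsto (fun k => a k - b k) atTop (𝓝 0)) (hb : CauchySeq fun k => G (b k)) :
    CauchySeq fun k => G (a k) := by
  obtain ⟨l, hl⟩ := cauchySeq_tendsto_of_complete hb
  have h := ((G.continuous.tendsto 0).comp hab).add hl
  refine (h.congr fun k => ?_).cauchySeq
  simp

theorem exists_box (hΩ : Bornology.IsBounded (Ω : Set Plane)) :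
    ∃ R : ℝ, (Ω : Set Plane) ⊆ Ioo (-R) R ×ˢ Ioo (-R) R := by
  obtain ⟨R, hR⟩ := hΩ.subset_ball 0
  refine ⟨R, fun x hx => ?_⟩
  have h := mem_ball_zero_iff.1 (hR hx)
  exact ⟨abs_lt.1 ((norm_fst_le x).trans_lt h), abs_lt.1 ((norm_snd_le x).trans_lt h)⟩

end EpitaxialGrowth

open EpitaxialGrowth in
theorem lemma3p3 (Ω : TopologicalSpace.Opens EpitaxialGrowth.Plane)
    (hΩ : Bornology.IsBounded (Ω : Set EpitaxialGrowth.Plane))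
    (f : EpitaxialGrowth.Plane → ℝ)
    (hf : MeasureTheory.IntegrableOn f (Ω : Set EpitaxialGrowth.Plane) MeasureTheory.volume)
    (lam c : ℝ) (u : ℕ → EpitaxialGrowth.W022 Ω)
    (hbdd : ∃ C : ℝ, ∀ k, ‖u k‖ ≤ C)
    (hPS : EpitaxialGrowth.IsPalaisSmale (EpitaxialGrowth.energy Ω f lam) c u) :
    ∃ g : ℕ → ℕ, StrictMono g ∧
      ∃ w : EpitaxialGrowth.W022 Ω, Filter.Tendsto (fun k => u (g k)) Filter.atTop (nhds w) := by
  obtain ⟨C, hC⟩ := hbdd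
  obtain ⟨R, hR⟩ := exists_box hΩ
  obtain ⟨G₀, h₀⟩ := W022.exists_val_clm hR
  obtain ⟨G₁, h₁⟩ := W022.exists_d1_clm hR
  obtain ⟨G₂, h₂⟩ := W022.exists_d2_clm hR
  obtain ⟨κ, hκ⟩ := W022.antilipschitz_laplacian hR
  have happrox : ∀ k, ∃ φ, dist (u k) (W022.ofTest Ω φ) < 1 / ((k : ℝ) + 1) := fun k =>
    W022.denseRange_ofTest.exists_dist_lt (u k) (by positivity)
  choose φ hφ using happrox
  -- it suffices to extract the subsequence for the approximating test functions
  have hsub : Tendsto (fun k => u k - W022.ofTest Ω (φ k)) atTop (𝓝 0) :=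
    squeeze_zero_norm (fun k => (dist_eq_norm (u k) _).symm.trans_le (hφ k).le)
      tendsto_one_div_add_atTop_nhds_zero_nat
  obtain ⟨B, hB⟩ : ∃ B, ∀ k, ‖W022.ofTest Ω (φ k)‖ ≤ B := by
    refine ⟨C + 1, fun k => ?_⟩
    have h1 : 1 / ((k : ℝ) + 1) ≤ 1 := by
      rw [div_le_one (by positivity)]; linarith [(Nat.cast_nonneg k : (0 : ℝ) ≤ k)]
    have h2 := hφ k
    rw [dist_comm, dist_eq_norm] at h2
    have h3 := norm_le_norm_add_norm_sub (u k) (W022.ofTest Ω (φ k))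
    rw [norm_sub_rev] at h3
    linarith [hC k]
  obtain ⟨g, hg, hunif⟩ := exists_subseq_uniformCauchy hR φ
    fun k => (W022.norm_mixed_le (φ k)).trans (hB k)
  refine ⟨g, hg, ?_⟩
  have c₁ : CauchySeq fun k => G₁ (u (g k)) :=
    cauchySeq_of_tendsto_sub G₁ (hsub.comp hg.tendsto_atTop)
      (cauchySeq_dirDeriv (1, 0) (fun ψ => (h₁ _).trans (coeFn_testToL2 _))
        W022.norm_pure_fst_le (fun k => hB (g k)) hunif)
  have c₂ : CauchySeq fun k => G₂ (u (g k)) :=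
    cauchySeq_of_tendsto_sub G₂ (hsub.comp hg.tendsto_atTop)
      (cauchySeq_dirDeriv (0, 1) (fun ψ => (h₂ _).trans (coeFn_testToL2 _))
        W022.norm_pure_snd_le (fun k => hB (g k)) hunif)
  have hJ := hPS.2.comp hg.tendsto_atTop
  rw [energy_eq hf lam h₀ h₁ h₂] at hJ
  have hLap := cauchySeq_of_tendsto_fderiv _ _ G₁ G₂ _ _ (fun k => hC (g k)) hJ c₁ c₂
  have : CompleteSpace (W022 Ω) :=
    (Submodule.isClosed_topologicalClosure _).completeSpace_coe
  have hind := hκ.isUniformInducing (W022.laplacian Ω).uniformContinuous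
  exact cauchySeq_tendsto_of_complete (hind.cauchy_map_iff.1 (by rwa [Filter.map_map]))
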